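/- Let $G\subseteq\mathbb R$ be a $G_\delta$ set and let $\mathcal C_G$ be the set of all functions $f:\mathbb R\to\mathbb R$ whose set of continuity points equals $G$. Let $U$ be the union of all open sets $I\subseteq\mathbb R$ such that $(\mathbb R\setminus G)\cap I$ is nonempty and countable (finite or infinite). Assume that $U\setminus G$ is nonempty and discrete (every point of $U\setminus G$ is isolated in $U\setminus G$). Then $\mathcal C_G$ is strongly $\mathfrak c$-algebrable in the real algebra $\mathbb R^{\mathbb R}$ with pointwise operations: there is a set $X\subseteq\mathbb R^{\mathbb R}$ of cardinality $\mathfrak c$ such that $P(x_1,\dots,x_n)\neq 0$ for all $n\ge 1$, all distinct $x_1,\dots,x_n\in X$ and every nonzero real polynomial $P$ in $n$ variables without constant term, and such that the (not necessarily unital) subalgebra of $\mathbb R^{\mathbb R}$ generated by $X$, which is thus free on $X$, is contained in $\mathcal C_G\cup\{0\}$. -/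

import Mathlib

/-- `X` is a set of free generators of the (non-unital) commutative `K`-algebra that it generates:
no nonzero polynomial without constant term vanishes on `X`. Equivalently, the evaluation map from
the free commutative non-unital `K`-algebra on `X`, that is, from the polynomials in the variables
`X` without constant term, to `A` is injective. -/
def IsFreeGenerating (K : Type*) {A : Type*} [Field K] [CommRing A] [Algebra K A]
    (X : Set A) : Prop :=
  ∀ P : MvPolynomial X K, MvPolynomial.constantCoeff P = 0 →
    MvPolynomial.aeval (fun x : X => (x : A)) P = 0 → P = 0

/-- `E` is strongly `κ`-algebrable: `E ∪ {0}` contains a (non-unital) subalgebra `B` of `A` that is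
free with a set of free generators of cardinality `κ`. -/
def StronglyAlgebrable (K : Type*) {A : Type*} [Field K] [CommRing A] [Algebra K A]
    (κ : Cardinal) (E : Set A) : Prop :=
  ∃ B : NonUnitalSubalgebra K A, (B : Set A) ⊆ E ∪ {0} ∧
    ∃ X : Set A, Cardinal.mk X = κ ∧ NonUnitalAlgebra.adjoin K X = B ∧ IsFreeGenerating K X

/-- The functions `ℝ → ℝ` whose set of continuity points is exactly `G`. -/
def continuityClass (G : Set ℝ) : Set (ℝ → ℝ) :=
  {f | {x | ContinuousAt f x} = G}

/-- The union of all open sets that meet `ℝ ∖ G` in a nonempty countable set. -/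
def countableTraceUnion (G : Set ℝ) : Set ℝ :=
  ⋃₀ {I | IsOpen I ∧ (Gᶜ ∩ I).Nonempty ∧ (Gᶜ ∩ I).Countable}

/-!
The functions `t ↦ exp (α i * t)`, with `α` linearly independent over `ℚ`, are real analytic and, by
independence of characters, algebraically independent. By the identity theorem a polynomial in them
that is constant on a set with an accumulation point is a constant polynomial. Hence it suffices to
find one function `f`, continuous on `G`, whose cluster set at each point outside `G` contains an
interval: a polynomial in the functions `exp (α i * f)` that is continuous at such a point takes a
single value on that interval.

The complement of `G` is the union of the zero sets of continuous functions `w k` with values in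
`[0, 1]`, and `f` is a series whose `k`-th term is the product of `w 0, …, w (k - 1)` with a bounded
function oscillating exactly at the zeros of `w k`. At a point outside `G`, only the term of the
first vanishing `w k` is discontinuous.
-/

open Filter Topology Set Cardinal

universe u v

theorem exists_aeval_eq_of_mem_nonUnital_adjoin {ι K A : Type*} [Field K] [CommRing A]
    [Algebra K A] {f : ι → A} {b : A} (hb : b ∈ NonUnitalAlgebra.adjoin K (range f)) :
    ∃ P : MvPolynomial ι K, MvPolynomial.constantCoeff P = 0 ∧ MvPolynomial.aeval f P = b := by
  induction hb using NonUnitalAlgebra.adjoin_induction with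
  | mem x hx =>
    obtain ⟨i, rfl⟩ := hx
    exact ⟨MvPolynomial.X i, by simp, by simp⟩
  | add x y _ _ hx hy =>
    obtain ⟨P, hP, rfl⟩ := hx
    obtain ⟨Q, hQ, rfl⟩ := hy
    exact ⟨P + Q, by simp [hP, hQ], by simp⟩
  | zero => exact ⟨0, by simp, by simp⟩
  | mul x y _ _ hx hy =>
    obtain ⟨P, hP, rfl⟩ := hx
    obtain ⟨Q, -, rfl⟩ := hy
    exact ⟨P * Q, by simp [hP], by simp⟩
  | smul r x _ hx =>
    obtain ⟨P, hP, rfl⟩ := hx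
    exact ⟨r • P, by simp [hP, MvPolynomial.smul_eq_C_mul], by simp⟩

theorem stronglyAlgebrable_of_algebraicIndependent {K : Type*} {ι A : Type u} [Field K]
    [CommRing A] [Algebra K A] {x : ι → A} (hx : AlgebraicIndependent K x) {S : Set A}
    (hS : ∀ P : MvPolynomial ι K, MvPolynomial.constantCoeff P = 0 → P ≠ 0 →
      MvPolynomial.aeval x P ∈ S) :
    StronglyAlgebrable K #ι S := by
  refine ⟨_, fun b hb => ?_, range x, mk_range_eq x hx.injective, rfl, fun P _ hP =>
    algebraicIndependent_iff.1 hx.coe_range P hP⟩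
  obtain ⟨P, hP0, rfl⟩ := exists_aeval_eq_of_mem_nonUnital_adjoin hb
  rcases eq_or_ne P 0 with rfl | hP
  · exact .inr (map_zero _)
  · exact .inl (hS P hP0 hP)

section Exponentials

theorem linearIndependent_exp_mul : LinearIndependent ℝ fun β t : ℝ => Real.exp (β * t) := by
  let χ (β : ℝ) : Multiplicative ℝ →* ℝ :=
    { toFun t := Real.exp (β * t.toAdd)
      map_one' := by simp
      map_mul' s t := by rw [toAdd_mul, mul_add, Real.exp_add] }
  have hχ : Function.Injective χ := fun β γ h => by
    simpa [χ] using DFunLike.congr_fun h (Multiplicative.ofAdd 1)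
  exact (linearIndependent_monoidHom (Multiplicative ℝ) ℝ).comp χ hχ

variable {ι : Type*}

theorem aeval_exp_mul_eq_sum (α : ι → ℝ) (P : MvPolynomial ι ℝ) :
    MvPolynomial.aeval (fun i t => Real.exp (α i * t)) P =
      ∑ m ∈ P.support, P.coeff m • fun t => Real.exp (Finsupp.linearCombination ℕ α m * t) := by
  rw [MvPolynomial.aeval_def, MvPolynomial.eval₂_eq]
  refine Finset.sum_congr rfl fun m _ => ?_
  ext t
  simp [Finsupp.linearCombination_apply, Finsupp.sum, Finset.sum_mul, Real.exp_sum, mul_assoc,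
    Real.exp_nat_mul]

theorem algebraicIndependent_exp_mul {α : ι → ℝ} (hα : LinearIndependent ℕ α) :
    AlgebraicIndependent ℝ fun i t => Real.exp (α i * t) := by
  rw [algebraicIndependent_iff]
  intro P hP
  have hind := linearIndependent_exp_mul.comp (Finsupp.linearCombination ℕ α) hα
  rw [aeval_exp_mul_eq_sum] at hP
  ext m
  by_contra hm
  exact hm (linearIndependent_iff'.1 hind P.support P.coeff hP m
    (MvPolynomial.mem_support_iff.2 hm))

end Exponentials

theorem aeval_pi_apply {ι X R A : Type*} [CommSemiring R] [CommSemiring A] [Algebra R A]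
    (E : ι → X → A) (P : MvPolynomial ι R) (x : X) :
    MvPolynomial.aeval E P x = MvPolynomial.aeval (fun i => E i x) P :=
  MvPolynomial.comp_aeval_apply E (Pi.evalAlgHom R (fun _ : X => A) x) P

theorem aeval_comp_right {ι X Y R A : Type*} [CommSemiring R] [CommSemiring A] [Algebra R A]
    (E : ι → Y → A) (f : X → Y) (P : MvPolynomial ι R) :
    MvPolynomial.aeval (fun i => E i ∘ f) P = MvPolynomial.aeval E P ∘ f := by
  ext x
  simp only [Function.comp_apply, aeval_pi_apply]

theorem mem_derivedSet_of_mem_nhds {X : Type*} [TopologicalSpace X] {x : X} [(𝓝[≠] x).NeBot]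
    {S : Set X} (hS : S ∈ 𝓝 x) : x ∈ derivedSet S :=
  accPt_iff_frequently_nhdsNE.2 (eventually_nhdsWithin_of_eventually_nhds hS).frequently

theorem mem_closure_range_of_mapClusterPt {X Y : Type*} [TopologicalSpace Y] {f : X → Y}
    {l : Filter X} {y : Y} (h : MapClusterPt y l f) : y ∈ closure (range f) :=
  mem_closure_iff_clusterPt.2 (h.clusterPt.mono (le_principal_iff.2 range_mem_map))

theorem derivedSet_setOf_mapClusterPt_subset {X Y : Type*} [TopologicalSpace Y] [T1Space Y]
    (f : X → Y) (l : Filter X) :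
    derivedSet {y | MapClusterPt y l f} ⊆ derivedSet (range f) := by
  rw [← derivedSet_closure (range f)]
  exact derivedSet_mono _ _ fun _ => mem_closure_range_of_mapClusterPt

section AnalyticFamilies

variable {𝕜 ι X : Type*} [NontriviallyNormedField 𝕜] {E : ι → 𝕜 → 𝕜} {P : MvPolynomial ι 𝕜}

theorem analyticOnNhd_aeval {s : Set 𝕜} (han : ∀ i, AnalyticOnNhd 𝕜 (E i) s)
    (P : MvPolynomial ι 𝕜) : AnalyticOnNhd 𝕜 (MvPolynomial.aeval E P) s := by
  rw [funext (aeval_pi_apply E P)]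
  exact .aeval_mvPolynomial han P

variable [ConnectedSpace 𝕜]

theorem eq_C_of_eqOn_of_derivedSet_nonempty (hE : AlgebraicIndependent 𝕜 E)
    (han : ∀ i, AnalyticOnNhd 𝕜 (E i) univ) {S : Set 𝕜} (hS : (derivedSet S).Nonempty) {r : 𝕜}
    (h : ∀ t ∈ S, MvPolynomial.aeval E P t = r) : P = MvPolynomial.C r := by
  obtain ⟨a, ha⟩ := hS
  have heq := (analyticOnNhd_aeval han P).eq_of_frequently_eq (g := fun _ => r)
    analyticOnNhd_const ((accPt_iff_frequently_nhdsNE.1 ha).mono h)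
  refine hE (heq.trans ?_)
  ext
  simp

theorem algebraicIndependent_comp_of_derivedSet_range_nonempty (hE : AlgebraicIndependent 𝕜 E)
    (han : ∀ i, AnalyticOnNhd 𝕜 (E i) univ) {f : X → 𝕜} (hf : (derivedSet (range f)).Nonempty) :
    AlgebraicIndependent 𝕜 fun i => E i ∘ f := by
  rw [algebraicIndependent_iff]
  intro P hP
  rw [aeval_comp_right] at hP
  rw [← MvPolynomial.C_0]
  exact eq_C_of_eqOn_of_derivedSet_nonempty hE han hf (forall_mem_range.2 (congrFun hP))

theorem eq_C_of_continuousAt_aeval_comp [TopologicalSpace X] (hE : AlgebraicIndependent 𝕜 E)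
    (han : ∀ i, AnalyticOnNhd 𝕜 (E i) univ) {f : X → 𝕜} {x : X}
    (hf : (derivedSet {s | MapClusterPt s (𝓝 x) f}).Nonempty)
    (hP : ContinuousAt (MvPolynomial.aeval E P ∘ f) x) :
    P = MvPolynomial.C (MvPolynomial.aeval E P (f x)) := by
  refine eq_C_of_eqOn_of_derivedSet_nonempty hE han hf fun s hs => ?_
  have hcont : ContinuousAt (MvPolynomial.aeval E P) s :=
    (analyticOnNhd_aeval han P s (mem_univ s)).continuousAt
  exact eq_of_nhds_neBot ((hs.continuousAt_comp hcont).clusterPt.mono hP)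

end AnalyticFamilies

theorem stronglyAlgebrable_setOf_continuousAt_eq {𝕜 : Type u} [NontriviallyNormedField 𝕜]
    [ConnectedSpace 𝕜] {X : Type v} [TopologicalSpace X] {ι : Type (max u v)} {E : ι → 𝕜 → 𝕜}
    (hE : AlgebraicIndependent 𝕜 E) (han : ∀ i, AnalyticOnNhd 𝕜 (E i) univ) {G : Set X}
    {f : X → 𝕜} (hrange : (derivedSet (range f)).Nonempty)
    (hcont : ∀ x ∈ G, ContinuousAt f x)
    (hcluster : ∀ x ∉ G, (derivedSet {s | MapClusterPt s (𝓝 x) f}).Nonempty) :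
    StronglyAlgebrable 𝕜 #ι {g : X → 𝕜 | {x | ContinuousAt g x} = G} := by
  refine stronglyAlgebrable_of_algebraicIndependent
    (algebraicIndependent_comp_of_derivedSet_range_nonempty hE han hrange) fun P hP0 hP => ?_
  ext x
  rw [mem_ofPred_eq, aeval_comp_right]
  refine ⟨fun hx => by_contra fun hxG => hP ?_, fun hxG => ?_⟩
  · have hPC := eq_C_of_continuousAt_aeval_comp hE han (hcluster x hxG) hx
    rw [hPC, MvPolynomial.constantCoeff_C] at hP0
    rw [hPC, hP0, MvPolynomial.C_0]
  · exact (analyticOnNhd_aeval han P _ (mem_univ _)).continuousAt.comp (hcont x hxG)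

theorem dense_mk_preimage_singleton {A : Type*} [AddGroup A] [TopologicalSpace A]
    [SeparatelyContinuousAdd A] {H : AddSubgroup A} (hH : Dense (H : Set A)) (q : A ⧸ H) :
    Dense ((QuotientAddGroup.mk : A → A ⧸ H) ⁻¹' {q}) := by
  obtain ⟨a, rfl⟩ := QuotientAddGroup.mk_surjective q
  have hcoset : (QuotientAddGroup.mk : A → A ⧸ H) ⁻¹' {(a : A ⧸ H)} = (a + ·) '' H := by
    rw [← image_singleton, QuotientAddGroup.preimage_image_mk_eq_add, singleton_add]
  rw [hcoset]
  exact (Homeomorph.addLeft a).surjective.denseRange.dense_image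
    (Homeomorph.addLeft a).continuous hH

theorem mk_quotient_of_countable {A : Type*} [AddGroup A] [Uncountable A] (H : AddSubgroup A)
    [Countable H] : #(A ⧸ H) = #A := by
  have hprod : #A = #(A ⧸ H) * #H := by
    rw [mk_congr (AddSubgroup.addGroupEquivQuotientProdAddSubgroup (s := H)), mk_prod, lift_id,
      lift_id]
  refine le_antisymm (mk_le_of_surjective QuotientAddGroup.mk_surjective) ?_
  by_contra! hlt
  have h := hprod.trans_le (mul_le_max _ _)
  simp only [le_sup_iff] at h
  have hA : ℵ₀ < #A := aleph0_lt_mk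
  have hH : #H ≤ ℵ₀ := mk_le_aleph0
  grind

theorem exists_forall_dense_preimage_singleton : ∃ c : ℝ → ℝ, ∀ t, Dense (c ⁻¹' {t}) := by
  let H := (Rat.castHom ℝ).toAddMonoidHom.range
  have hH : Dense (H : Set ℝ) := Rat.isDenseEmbedding_coe_real.dense
  have : Countable H := (countable_range (Rat.castHom ℝ)).to_subtype
  obtain ⟨e⟩ := Cardinal.eq.1 (mk_quotient_of_countable H)
  refine ⟨fun x => e x, fun t => ?_⟩
  convert dense_mk_preimage_singleton hH (e.symm t) using 1
  ext x
  simp [Equiv.eq_symm_apply]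

section Oscillation

variable {X : Type*}

/-- A bounded function oscillating at the zeros of `w`: it is `sin (1 / w)` off the zero set of `w`,
and `sin ∘ c` on it, which keeps it oscillating in the interior of the zero set when the fibers of
`c` are dense. -/
noncomputable def reciprocalOscillation (c w : X → ℝ) (y : X) : ℝ :=
  Real.sin (if w y = 0 then c y else (w y)⁻¹)

theorem norm_reciprocalOscillation_le_one (c w : X → ℝ) (y : X) :
    ‖reciprocalOscillation c w y‖ ≤ 1 :=
  Real.abs_sin_le_one _

variable [TopologicalSpace X] {c : X → ℝ}

theorem continuousAt_reciprocalOscillation {w : X → ℝ} {x : X} (hw : ContinuousAt w x)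
    (hx : w x ≠ 0) : ContinuousAt (reciprocalOscillation c w) x := by
  have heq : reciprocalOscillation c w =ᶠ[𝓝 x] fun y => Real.sin (w y)⁻¹ := by
    filter_upwards [hw.eventually_ne hx] with y hy
    rw [reciprocalOscillation, if_neg hy]
  exact (Real.continuous_sin.continuousAt.comp (hw.inv₀ hx)).congr heq.symm

theorem frequently_reciprocalOscillation_eq_sin [LocallyConnectedSpace X]
    (hc : ∀ t, Dense (c ⁻¹' {t})) {w : X → ℝ} (hw : Continuous w) (hw0 : 0 ≤ w) {x : X}
    (hx : w x = 0) (t : ℝ) : ∃ᶠ y in 𝓝 x, reciprocalOscillation c w y = Real.sin t := by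
  rw [(LocallyConnectedSpace.open_connected_basis x).frequently_iff]
  rintro V ⟨hVo, hxV, hVc⟩
  -- On the connected set `V`, either `w = 0` throughout or `1 / w` takes all large values.
  by_cases hV : ∀ y ∈ V, w y = 0
  · obtain ⟨y, hyV, rfl⟩ := (hc t).inter_open_nonempty V hVo ⟨x, hxV⟩
    exact ⟨y, hyV, by rw [reciprocalOscillation, if_pos (hV y hyV)]⟩
  push Not at hV
  obtain ⟨y, hyV, hy⟩ := hV
  have hy0 : 0 < w y := (hw0 y).lt_of_ne' hy
  obtain ⟨n, hn⟩ := exists_nat_gt (((w y)⁻¹ - t) / (2 * Real.pi))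
  have hlarge : (w y)⁻¹ < t + n * (2 * Real.pi) := by
    rwa [div_lt_iff₀ Real.two_pi_pos, sub_lt_iff_lt_add'] at hn
  have hpos : 0 < t + n * (2 * Real.pi) := (inv_pos.2 hy0).trans hlarge
  obtain ⟨z, hzV, hz⟩ := hVc.isPreconnected.intermediate_value hxV hyV hw.continuousOn
    ⟨hx.trans_le (inv_pos.2 hpos).le, (inv_lt_of_inv_lt₀ hy0 hlarge).le⟩
  refine ⟨z, hzV, ?_⟩
  rw [reciprocalOscillation, hz, if_neg (inv_pos.2 hpos).ne', inv_inv, Real.sin_add_nat_mul_two_pi]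

end Oscillation

section OscillatingSeries

variable {X : Type*} {c : X → ℝ} {w : ℕ → X → ℝ}

/-- The `k`-th summand of `oscillatingSeries c w`. The factor `w 0 * ⋯ * w (k - 1)` makes it
continuous at the zeros of the earlier functions. -/
noncomputable def oscillatingTerm (c : X → ℝ) (w : ℕ → X → ℝ) (k : ℕ) (y : X) : ℝ :=
  (1 / 2) ^ k * (∏ j ∈ Finset.range k, w j y) * reciprocalOscillation c (w k) y

/-- A sum of damped oscillations, continuous exactly off the union of the zero sets of the `w k`
when the `w k` are continuous with values in `[0, 1]` and the fibers of `c` are dense. -/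
noncomputable def oscillatingSeries (c : X → ℝ) (w : ℕ → X → ℝ) (y : X) : ℝ :=
  ∑' k, oscillatingTerm c w k y

theorem norm_oscillatingTerm_le (hw01 : ∀ k y, w k y ∈ Icc (0 : ℝ) 1) (k : ℕ) (y : X) :
    ‖oscillatingTerm c w k y‖ ≤ (1 / 2) ^ k := by
  have hprod0 : 0 ≤ ∏ j ∈ Finset.range k, w j y := Finset.prod_nonneg fun j _ => (hw01 j y).1
  have hprod1 : ∏ j ∈ Finset.range k, w j y ≤ 1 :=
    Finset.prod_le_one (fun j _ => (hw01 j y).1) fun j _ => (hw01 j y).2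
  rw [oscillatingTerm, norm_mul, Real.norm_of_nonneg (by positivity)]
  exact (mul_le_of_le_one_right (by positivity) (norm_reciprocalOscillation_le_one c (w k) y)).trans
    (mul_le_of_le_one_right (by positivity) hprod1)

variable [TopologicalSpace X]

theorem continuousAt_oscillatingTerm_of_ne_zero {x : X} (hw : ∀ k, ContinuousAt (w k) x)
    {k : ℕ} (hx : w k x ≠ 0) : ContinuousAt (oscillatingTerm c w k) x := by
  have hosc := continuousAt_reciprocalOscillation (c := c) (hw k) hx
  unfold oscillatingTerm
  fun_prop

theorem continuousAt_oscillatingTerm_of_eq_zero {x : X} (hw : ∀ k, ContinuousAt (w k) x)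
    {j k : ℕ} (hjk : j < k) (hx : w j x = 0) : ContinuousAt (oscillatingTerm c w k) x := by
  have hcoeff : (1 / 2 : ℝ) ^ k * ∏ i ∈ Finset.range k, w i x = 0 := by
    rw [Finset.prod_eq_zero (Finset.mem_range.2 hjk) hx, mul_zero]
  have hlim : ContinuousAt (fun y => (1 / 2 : ℝ) ^ k * ∏ i ∈ Finset.range k, w i y) x := by fun_prop
  rw [ContinuousAt, hcoeff] at hlim
  rw [ContinuousAt, oscillatingTerm, hcoeff, zero_mul]
  exact hlim.zero_mul_isBoundedUnder_le
    (isBoundedUnder_of ⟨1, norm_reciprocalOscillation_le_one c (w k)⟩)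

theorem continuousAt_oscillatingSeries_of_ne_zero (hw01 : ∀ k y, w k y ∈ Icc (0 : ℝ) 1) {x : X}
    (hw : ∀ k, ContinuousAt (w k) x) (hx : ∀ k, w k x ≠ 0) :
    ContinuousAt (oscillatingSeries c w) x :=
  tendsto_tsum_of_dominated_convergence summable_geometric_two
    (fun k => continuousAt_oscillatingTerm_of_ne_zero hw (hx k))
    (.of_forall fun y k => norm_oscillatingTerm_le hw01 k y)

theorem exists_oscillatingSeries_eq_add (hw01 : ∀ k y, w k y ∈ Icc (0 : ℝ) 1) {x : X}
    (hw : ∀ k, ContinuousAt (w k) x) {n : ℕ} (hx : w n x = 0)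
    (hlt : ∀ k < n, w k x ≠ 0) :
    ∃ g : X → ℝ, ContinuousAt g x ∧
      ∀ y, oscillatingSeries c w y = oscillatingTerm c w n y + g y := by
  refine ⟨fun y => ∑' k, if k = n then 0 else oscillatingTerm c w k y, ?_, fun y => ?_⟩
  · refine tendsto_tsum_of_dominated_convergence summable_geometric_two (fun k => ?_)
      (.of_forall fun y k => ?_)
    · rcases lt_trichotomy k n with hk | rfl | hk
      · simpa only [ContinuousAt, if_neg hk.ne] using
          continuousAt_oscillatingTerm_of_ne_zero hw (hlt k hk)
      · simp
      · simpa only [ContinuousAt, if_neg hk.ne'] using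
          continuousAt_oscillatingTerm_of_eq_zero hw hk hx
    · split_ifs
      · simp
      · exact norm_oscillatingTerm_le hw01 k y
  · exact (Summable.of_norm_bounded summable_geometric_two
      fun k => norm_oscillatingTerm_le hw01 k y).tsum_eq_add_tsum_ite n

theorem mapClusterPt_mul_add_of_frequently_eq {δ u g : X → ℝ} {x : X} (hδ : ContinuousAt δ x)
    (hg : ContinuousAt g x) {v : ℝ} (hu : ∃ᶠ y in 𝓝 x, u y = v) :
    MapClusterPt (δ x * v + g x) (𝓝 x) fun y => δ y * u y + g y := by
  let l := 𝓝 x ⊓ 𝓟 {y | u y = v}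
  have : l.NeBot := frequently_mem_iff_neBot.1 hu
  have hlim : Tendsto (fun y => δ y * v + g y) l (𝓝 (δ x * v + g x)) :=
    ((hδ.mul_const v).add hg).mono_left inf_le_left
  have heq : (fun y => δ y * v + g y) =ᶠ[l] fun y => δ y * u y + g y := by
    filter_upwards [mem_inf_of_right (mem_principal_self _)] with y (hy : u y = v)
    rw [hy]
  exact (hlim.congr' heq).mapClusterPt.mono inf_le_left

theorem derivedSet_mapClusterPt_oscillatingSeries_nonempty [LocallyConnectedSpace X]
    (hc : ∀ t, Dense (c ⁻¹' {t})) (hw : ∀ k, Continuous (w k))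
    (hw01 : ∀ k y, w k y ∈ Icc (0 : ℝ) 1) {x : X} (hx : ∃ k, w k x = 0) :
    (derivedSet {s | MapClusterPt s (𝓝 x) (oscillatingSeries c w)}).Nonempty := by
  classical
  let n := Nat.find hx
  have hlt : ∀ k < n, w k x ≠ 0 := fun k => Nat.find_min hx
  obtain ⟨g, hg, hsum⟩ :=
    exists_oscillatingSeries_eq_add (c := c) hw01 (fun k => (hw k).continuousAt)
      (Nat.find_spec hx) hlt
  let δ (y : X) : ℝ := (1 / 2) ^ n * ∏ j ∈ Finset.range n, w j y
  have hδ : Continuous δ := by fun_prop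
  have hδx : 0 < δ x := mul_pos (by positivity) (Finset.prod_pos fun j hj =>
    (hw01 j x).1.lt_of_ne' (hlt j (Finset.mem_range.1 hj)))
  refine ⟨g x, mem_derivedSet_of_mem_nhds ?_⟩
  filter_upwards [Metric.ball_mem_nhds (g x) hδx] with s hs
  rw [Real.ball_eq_Ioo, mem_Ioo] at hs
  obtain ⟨t, rfl⟩ : ∃ t, δ x * Real.sin t + g x = s := by
    refine ⟨Real.arcsin ((s - g x) / δ x), ?_⟩
    rw [Real.sin_arcsin, mul_div_cancel₀ _ hδx.ne', sub_add_cancel]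
    · rw [le_div_iff₀ hδx]; linarith
    · rw [div_le_iff₀ hδx]; linarith
  rw [funext hsum]
  exact mapClusterPt_mul_add_of_frequently_eq hδ.continuousAt hg <|
    frequently_reciprocalOscillation_eq_sin hc (hw n) (fun y => (hw01 n y).1) (Nat.find_spec hx) t

theorem exists_continuousAt_and_derivedSet_mapClusterPt_nonempty [PerfectlyNormalSpace X]
    [LocallyConnectedSpace X] (hc : ∀ t, Dense (c ⁻¹' {t})) {G : Set X} (hG : IsGδ G) :
    ∃ f : X → ℝ, (∀ x ∈ G, ContinuousAt f x) ∧
      ∀ x ∉ G, (derivedSet {s | MapClusterPt s (𝓝 x) f}).Nonempty := by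
  obtain ⟨O, hO, rfl⟩ := hG.eq_iInter_nat
  choose w hw0 hw01 using fun k => perfectlyNormalSpace_iff_forall_isClosed_preimage_zero.1
    ‹PerfectlyNormalSpace X› _ (hO k).isClosed_compl
  have hmem (k : ℕ) (x : X) : x ∈ O k ↔ w k x ≠ 0 := by
    simpa using (Set.ext_iff.1 (hw0 k) x).not
  refine ⟨oscillatingSeries c fun k => w k, fun x hx => ?_, fun x hx => ?_⟩
  · exact continuousAt_oscillatingSeries_of_ne_zero hw01 (fun k => (w k).continuous.continuousAt)
      fun k => (hmem k x).1 (mem_iInter.1 hx k)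
  · refine derivedSet_mapClusterPt_oscillatingSeries_nonempty hc (fun k => (w k).continuous) hw01 ?_
    simpa [hmem] using hx

end OscillatingSeries

theorem exists_linearIndependent_rat_real_mk_eq_continuum :
    ∃ (ι : Type) (α : ι → ℝ), LinearIndependent ℚ α ∧ #ι = continuum := by
  let b := Module.Basis.ofVectorSpace ℚ ℝ
  exact ⟨_, b, b.linearIndependent, by rw [b.mk_eq_rank'', Real.rank_rat_real]⟩

theorem exists_continuousAt_and_derivedSet_range_nonempty {G : Set ℝ} (hG : IsGδ G) :
    ∃ f : ℝ → ℝ, (derivedSet (range f)).Nonempty ∧ (∀ x ∈ G, ContinuousAt f x) ∧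
      ∀ x ∉ G, (derivedSet {s | MapClusterPt s (𝓝 x) f}).Nonempty := by
  rcases eq_or_ne G univ with rfl | hne
  · refine ⟨id, ⟨0, mem_derivedSet_of_mem_nhds ?_⟩, fun x _ => continuousAt_id,
      fun x hx => (hx (mem_univ x)).elim⟩
    rw [range_id]
    exact univ_mem
  · obtain ⟨c, hc⟩ := exists_forall_dense_preimage_singleton
    obtain ⟨f, hcont, hcluster⟩ := exists_continuousAt_and_derivedSet_mapClusterPt_nonempty hc hG
    obtain ⟨x, hx⟩ := (ne_univ_iff_exists_notMem G).1 hne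
    exact ⟨f, (hcluster x hx).mono (derivedSet_setOf_mapClusterPt_subset f _), hcont, hcluster⟩

theorem mainTheorem12_general {G : Set ℝ} (hG : IsGδ G) :
    StronglyAlgebrable ℝ Cardinal.continuum (continuityClass G) := by
  obtain ⟨ι, α, hα, hι⟩ := exists_linearIndependent_rat_real_mk_eq_continuum
  obtain ⟨f, hrange, hcont, hcluster⟩ := exists_continuousAt_and_derivedSet_range_nonempty hG
  have hE : AlgebraicIndependent ℝ fun i t => Real.exp (α i * t) :=
    algebraicIndependent_exp_mul (hα.restrict_scalars' ℕ)
  have han (i : ι) : AnalyticOnNhd ℝ (fun t => Real.exp (α i * t)) univ :=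
    (analyticOnNhd_const.mul analyticOnNhd_id).rexp
  rw [← hι]
  exact stronglyAlgebrable_setOf_continuousAt_eq hE han hrange hcont hcluster

theorem mainTheorem12 (G : Set ℝ) (hG : IsGδ G)
    (hne : (countableTraceUnion G \ G).Nonempty)
    (hdisc : IsDiscrete (countableTraceUnion G \ G)) :
    StronglyAlgebrable ℝ Cardinal.continuum (continuityClass G) :=
  mainTheorem12_general hG
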